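/- Let $\rho$ be the Hurwitz–Radon function: $\rho(M)=8\alpha+2^{\beta}$ if $M=2^{4\alpha+\beta}(2\gamma+1)$ with integers $\alpha,\gamma\ge 0$ and $0\le\beta\le 3$. A *square identity of size $[r,s,N]$* is an identity $$(a_1^2+\cdots+a_r^2)(b_1^2+\cdots+b_s^2)=c_1^2+\cdots+c_N^2,$$ where $a_1,\dots,a_r,b_1,\dots,b_s$ are indeterminates and each $c_m$ is a bilinear form in $a=(a_i)$ and $b=(b_j)$ with coefficients in $\mathbb{R}$. Theorem. Let $n>4$ and $1\le l<k\le n$ be integers, and put $r=\rho(2^n)$ and $s=2\left(\binom{k-1}{2}+l+1\right)$. 1. Suppose $n\equiv 1,2 \pmod 4$, and put $N=2\left(\binom{k-1}{2}+l+1\right)n-4\binom{k}{3}-2kl$. - If $k\le n-2$, there is a square identity of size $[r,s,N]$. - If $k=n-1$ and $l\le n-3$, there is a square identity of size $[r,s+2l,N]$. - If $k=n-1$ and $l=n-2$, there is a square identity of size $[r,s+2l+2,N]$. - If $k=n$, there is a square identity of size $[r,s+2(n-1-l),N]$. 2. Suppose $n\ge 8$ and $n\equiv 0,3 \pmod 4$,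 and put $N=2\left(\binom{k-1}{2}+l+1\right)(n+1)-4\binom{k}{3}-2kl$. - If $k\le n-1$, there is a square identity of size $[r,s,N]$. - If $k=n$ and $l\le n-2$, there is a square identity of size $[r,s+2l,N]$. - If $k=n$ and $l=n-1$, there is a square identity of size $[r,s+2l+2,N]$. -/

import Mathlib

/-- A square identity of size `[r, s, N]` over the field `K`:
`(a₁² + ⋯ + a_r²) (b₁² + ⋯ + b_s²) = c₁² + ⋯ + c_N²`,
where the `aᵢ` (`X (Sum.inl i)`) and the `bⱼ` (`X (Sum.inr j)`) are independent indeterminates and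
each `c_m = ∑ᵢⱼ γ m i j aᵢ bⱼ` is a bilinear form in `a` and `b` with coefficients in `K`. -/
def HasSquareIdentity (K : Type*) [Field K] (r s N : ℕ) : Prop :=
  ∃ γ : Fin N → Fin r → Fin s → K,
    (∑ i : Fin r, (MvPolynomial.X (Sum.inl i) : MvPolynomial (Fin r ⊕ Fin s) K) ^ 2) *
        (∑ j : Fin s, (MvPolynomial.X (Sum.inr j) : MvPolynomial (Fin r ⊕ Fin s) K) ^ 2) =
      ∑ m : Fin N, (∑ i : Fin r, ∑ j : Fin s,
        MvPolynomial.C (γ m i j) * MvPolynomial.X (Sum.inl i) * MvPolynomial.X (Sum.inr j)) ^ 2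

/-- The Hurwitz–Radon function: `ρ(N) = 8α + 2^β` for `N = 2^(4α+β) (2γ+1)` with `0 ≤ β ≤ 3`.
The exponent of `2` in `N` is `padicValNat 2 N = 4α + β`. -/
def hurwitzRadon (N : ℕ) : ℕ :=
  8 * (padicValNat 2 N / 4) + 2 ^ (padicValNat 2 N % 4)

/-! Fix a graph on `n` vertices. Rows are vertices, columns are edges and `∅`, outputs are the sets
obtained by toggling a vertex in a column, all carrying an extra bit; over `ZMod 2`, row plus column
is the output. Signs from suitable characters make distinct rows orthogonal
(`HasSquareIdentity.of_characters`), giving size `[2n, 2(1 + #edges), 2(n + #triples containing an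
edge)]` (`HasSquareIdentity.of_pairs`).

The value of `N` comes from a clique on `k - 1` vertices plus one vertex joined to `l` of them. In
the boundary cases more edges fit without any new triple, so the number of columns grows at the same
`N`. Since `ρ(2^n)` is `2n` or at most `2(n + 1)` according to `n` mod 4, the second half uses `n +
1` vertices. -/

open MvPolynomial in
/-- A signed multiplication table in which any two distinct rows are orthogonal gives a square
identity. -/
theorem HasSquareIdentity.of_signed_table {K : Type*} [Field K] [CharZero K] {r s N : ℕ}
    (μ : Fin r → Fin s → Fin N) (σ : Fin r → Fin s → K)
    (hσ : ∀ i j, σ i j * σ i j = 1) (hμ : ∀ i, Function.Injective (μ i))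
    (hswap : ∀ i i' j j', i ≠ i' → μ i j = μ i' j' →
      μ i j' = μ i' j ∧ σ i j * σ i' j' + σ i j' * σ i' j = 0) :
    HasSquareIdentity K r s N := by
  classical
  refine ⟨fun m i j => if μ i j = m then σ i j else 0, ?_⟩
  set a : Fin r → MvPolynomial (Fin r ⊕ Fin s) K := fun i => X (Sum.inl i) with ha
  set b : Fin s → MvPolynomial (Fin r ⊕ Fin s) K := fun j => X (Sum.inr j) with hb
  let F : Fin r → Fin s → Fin r → Fin s → MvPolynomial (Fin r ⊕ Fin s) K := fun i j i' j' =>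
    if μ i j = μ i' j' then C (σ i j * σ i' j') * (a i * b j * (a i' * b j')) else 0
  have hR : ∑ m : Fin N, (∑ i : Fin r, ∑ j : Fin s,
        C (if μ i j = m then σ i j else 0) * a i * b j) ^ 2
      = ∑ i, ∑ i', ∑ j, ∑ j', F i j i' j' := by
    have : ∀ m : Fin N, (∑ i : Fin r, ∑ j : Fin s,
        C (if μ i j = m then σ i j else 0) * a i * b j) ^ 2
        = ∑ i, ∑ i', ∑ j, ∑ j', if μ i j = m then F i j i' j' else 0 := by
      intro m
      rw [sq, Finset.sum_mul_sum]
      refine Finset.sum_congr rfl fun i _ => Finset.sum_congr rfl fun i' _ => ?_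
      rw [Finset.sum_mul_sum]
      refine Finset.sum_congr rfl fun j _ => Finset.sum_congr rfl fun j' _ => ?_
      simp only [F]
      by_cases h1 : μ i j = m
      · by_cases h2 : μ i' j' = m
        · simp only [h1, h2, if_true, C_mul]; ring
        · simp [h1, h2, Ne.symm h2]
      · simp [h1]
    rw [Finset.sum_congr rfl fun m _ => this m, Finset.sum_comm]
    refine Finset.sum_congr rfl fun i _ => ?_
    rw [Finset.sum_comm]
    refine Finset.sum_congr rfl fun i' _ => ?_
    rw [Finset.sum_comm]
    refine Finset.sum_congr rfl fun j _ => ?_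
    rw [Finset.sum_comm]
    exact Finset.sum_congr rfl fun j' _ => by simp
  -- Exchanging `j` and `j'` pairs each mixed term with its negative. Using both orders doubles the
  -- sum, so the identity is proved times `2`.
  have hpt : ∀ i i' j j', F i j i' j' + F i j' i' j
      = if i = i' then (if j = j' then 2 * (a i ^ 2 * b j ^ 2) else 0) else 0 := by
    intro i i' j j'
    by_cases hi : i = i'
    · subst hi
      by_cases hj : j = j'
      · subst hj
        simp only [F, if_true, hσ, C_1]; ring
      · simp [F, hj, Ne.symm hj, (hμ i).eq_iff]
    · rw [if_neg hi]
      by_cases h : μ i j = μ i' j'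
      · obtain ⟨h', h0⟩ := hswap i i' j j' hi h
        simp only [F, h, h', if_true]
        have : C (σ i j * σ i' j') * (a i * b j * (a i' * b j'))
            + C (σ i j' * σ i' j) * (a i * b j' * (a i' * b j))
            = C (σ i j * σ i' j' + σ i j' * σ i' j) * (a i * b j * (a i' * b j')) := by
          rw [C_add]; ring
        rw [this, h0]; simp
      · have h' : μ i j' ≠ μ i' j := fun h' => h (hswap i i' j' j hi h').1
        simp [F, h, h']
  refine mul_left_cancel₀ (two_ne_zero : (2 : MvPolynomial (Fin r ⊕ Fin s) K) ≠ 0) ?_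
  change 2 * ((∑ i, a i ^ 2) * ∑ j, b j ^ 2) = 2 * ∑ m : Fin N, (∑ i : Fin r, ∑ j : Fin s,
        C (if μ i j = m then σ i j else 0) * a i * b j) ^ 2
  have key : 2 * ∑ i, ∑ i', ∑ j, ∑ j', F i j i' j'
      = ∑ i, ∑ i', ∑ j, ∑ j', (F i j i' j' + F i j' i' j) := by
    rw [two_mul, ← Finset.sum_add_distrib]
    refine Finset.sum_congr rfl fun i _ => ?_
    rw [← Finset.sum_add_distrib]
    refine Finset.sum_congr rfl fun i' _ => ?_
    nth_rewrite 2 [Finset.sum_comm]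
    simp only [Finset.sum_add_distrib]
  rw [hR, key]
  simp only [hpt]
  rw [Finset.sum_mul_sum, Finset.mul_sum]
  refine Finset.sum_congr rfl fun i _ => ?_
  rw [Finset.sum_eq_single i (fun i' _ h => by simp [Ne.symm h]) (by simp), Finset.mul_sum]
  simp

/-- A family of characters `g i` of an elementary abelian `2`-group, indexed by points `ι i`, with
`g i + g j` odd at `ι i + ι j`, turns translations by the `ι i` into a square identity. -/
theorem HasSquareIdentity.of_characters {K : Type*} [Field K] [CharZero K] {V A : Type*}
    [AddCommGroup V] [DecidableEq V] [Fintype A] (htwo : ∀ v : V, v + v = 0)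
    (ι : A → V) (g : A → V →+ ZMod 2)
    (hg : ∀ x y, x ≠ y → g x (ι x + ι y) + g y (ι x + ι y) = 1)
    (B O : Finset V) (hO : ∀ x, ∀ v ∈ B, ι x + v ∈ O) {r s N : ℕ}
    (hr : r ≤ Fintype.card A) (hs : s ≤ B.card) (hN : O.card ≤ N) :
    HasSquareIdentity K r s N := by
  obtain ⟨eA⟩ : Nonempty (Fin r ↪ A) := Function.Embedding.nonempty_of_card_le (by simpa using hr)
  obtain ⟨eB⟩ : Nonempty (Fin s ↪ B) := Function.Embedding.nonempty_of_card_le (by simpa using hs)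
  obtain ⟨eO⟩ : Nonempty (O ↪ Fin N) := Function.Embedding.nonempty_of_card_le (by simpa using hN)
  let χ : ZMod 2 → K := fun t => if t = 0 then 1 else -1
  have hχ : ∀ t, χ t * χ t = 1 := fun t => by simp only [χ]; split_ifs <;> simp
  have hχ' : ∀ p q p' q' : ZMod 2, p + q + (p' + q') = 1 → χ p * χ q + χ p' * χ q' = 0 := by
    intro p q p' q'
    have h01 : ∀ t : ZMod 2, t = 0 ∨ t = 1 := by decide
    rcases h01 p with rfl | rfl <;> rcases h01 q with rfl | rfl <;>
    rcases h01 p' with rfl | rfl <;> rcases h01 q' with rfl | rfl <;>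
      first
        | (intro h; exact absurd h (by decide))
        | (intro _; simp [χ])
  refine .of_signed_table (fun i j => eO ⟨ι (eA i) + eB j, hO _ _ (eB j).2⟩)
    (fun i j => χ (g (eA i) (eB j))) (fun i j => hχ _) (fun i j j' h => ?_) ?_
  · have := congrArg Subtype.val (eO.injective h)
    exact eB.injective (Subtype.ext (add_left_cancel this))
  · intro i i' j j' hi h
    have h := congrArg Subtype.val (eO.injective h)
    change ι (eA i) + (eB j : V) = ι (eA i') + (eB j' : V) at h
    set x := eA i
    set y := eA i'
    have hxy : x ≠ y := fun e => hi (eA.injective e)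
    set v : V := (eB j).1
    set w : V := (eB j').1
    have hvw : v + w = ι x + ι y := by
      calc v + w = (ι x + ι x) + v + w := by rw [htwo, zero_add]
        _ = ι x + (ι x + v) + w := by abel
        _ = ι x + ι y + (w + w) := by rw [h]; abel
        _ = ι x + ι y := by rw [htwo, add_zero]
    have hsw : ι x + w = ι y + v := by
      calc ι x + w = ι x + w + (v + v) := by rw [htwo, add_zero]
        _ = ι x + (v + w) + v := by abel
        _ = (ι x + ι x) + ι y + v := by rw [hvw]; abel
        _ = ι y + v := by rw [htwo, zero_add]
    refine ⟨congrArg eO (Subtype.ext hsw), hχ' _ _ _ _ ?_⟩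
    rw [← hg x y hxy, ← hvw, map_add, map_add]; abel

/-! ### Set systems as columns and outputs -/

/-- The indicator of a finite set of natural numbers, as a vector over the field with two
elements. -/
def indVec (S : Finset ℕ) : ℕ → ZMod 2 := fun j => if j ∈ S then 1 else 0

theorem indVec_injective : Function.Injective indVec := by
  intro S T h
  ext j
  have := congrFun h j
  by_cases h1 : j ∈ S <;> by_cases h2 : j ∈ T <;> simp [indVec, h1, h2] at this ⊢

theorem indVec_singleton_add (i : ℕ) (S : Finset ℕ) :
    indVec {i} + indVec S = indVec (symmDiff {i} S) := by
  funext j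
  have two0 : (1 : ZMod 2) + 1 = 0 := by decide
  by_cases h1 : j = i <;> by_cases h2 : j ∈ S <;>
    simp [indVec, Finset.mem_symmDiff, h1] <;> simp_all

/-- The sum of the coordinates in `T`. -/
def coordSum (T : Finset ℕ) : (ℕ → ZMod 2) →+ ZMod 2 where
  toFun v := ∑ j ∈ T, v j
  map_zero' := by simp
  map_add' v w := by simp [Finset.sum_add_distrib]

theorem coordSum_singleton (T : Finset ℕ) (i : ℕ) :
    coordSum T (indVec {i}) = if i ∈ T then 1 else 0 := by
  simp [coordSum, indVec]

/-- The square identity attached to set systems `B`, `O` such that toggling any of the points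
`0, …, n - 1` in a member of `B` gives a member of `O`. -/
theorem HasSquareIdentity.of_set_systems {K : Type*} [Field K] [CharZero K] (n : ℕ)
    (B O : Finset (Finset ℕ)) (hO : ∀ i < n, ∀ S ∈ B, symmDiff {i} S ∈ O) {r s N : ℕ}
    (hr : r ≤ 2 * n) (hs : s ≤ 2 * B.card) (hN : 2 * O.card ≤ N) :
    HasSquareIdentity K r s N := by
  classical
  -- At `e_i + e_j` with `i < j`, the later coordinates count only for `i` and the earlier ones only
  -- for `j`. The bit summand corrects the parity when the two bits differ.
  let g : Fin n × ZMod 2 → ((ℕ → ZMod 2) × ZMod 2) →+ ZMod 2 := fun x =>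
    if x.2 = 0 then (coordSum (Finset.Ioo x.1 n)).comp (AddMonoidHom.fst _ _)
    else (coordSum (Finset.range x.1)).comp (AddMonoidHom.fst _ _) + AddMonoidHom.snd _ _
  let D : Finset (Finset ℕ) → Finset ((ℕ → ZMod 2) × ZMod 2) := fun S =>
    (S.image indVec) ×ˢ Finset.univ
  have hD : ∀ S, (D S).card = 2 * S.card := fun S => by
    rw [Finset.card_product, Finset.card_image_of_injective _ indVec_injective, mul_comm]
    rfl
  have two0 : ∀ t : ZMod 2, t + t = 0 := by decide
  refine .of_characters (V := (ℕ → ZMod 2) × ZMod 2) (A := Fin n × ZMod 2)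
    (fun v => Prod.ext (funext fun j => two0 _) (two0 _))
    (fun x => (indVec {(x.1 : ℕ)}, x.2)) g ?_ (D B) (D O) ?_ (by simpa [mul_comm] using hr)
    (by rwa [hD]) (by rwa [hD])
  · rintro ⟨i, e⟩ ⟨j, f⟩ hne
    have h01 : ∀ t : ZMod 2, t = 0 ∨ t = 1 := by decide
    have h2 : (1 : ZMod 2) + 1 = 0 := by decide
    rcases lt_trichotomy i j with h | h | h
    all_goals
      rcases h01 e with rfl | rfl <;> rcases h01 f with rfl | rfl <;>
      simp_all [g, coordSum_singleton, not_lt_of_gt]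
  · rintro ⟨i, e⟩ ⟨v, f⟩ hv
    obtain ⟨hv, -⟩ := Finset.mem_product.1 hv
    obtain ⟨S, hS, rfl⟩ := Finset.mem_image.1 hv
    refine Finset.mem_product.2 ⟨?_, Finset.mem_univ _⟩
    exact Finset.mem_image.2 ⟨_, hO i i.2 S hS, (indVec_singleton_add _ _).symm⟩

/-! ### Edges of a graph and the triples containing them -/

/-- The pairs `{a, b}` with `a < d b` and `b < n`, together with the empty set. -/
def pairSystem (n : ℕ) (d : ℕ → ℕ) : Finset (Finset ℕ) :=
  insert ∅ (((Finset.range n).sigma fun b => Finset.range (d b)).image fun p => {p.2, p.1})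

/-- The singletons and the triples `{a, b, c}` with `a < d b` and `b < c < n`. -/
def tripleSystem (n : ℕ) (d : ℕ → ℕ) : Finset (Finset ℕ) :=
  (Finset.range n).image (fun i => {i}) ∪
    ((Finset.range n).sigma fun b => Finset.range (d b) ×ˢ Finset.Ioo b n).image
      fun p => {p.2.1, p.1, p.2.2}

theorem card_pairSystem (n : ℕ) (d : ℕ → ℕ) (hd : ∀ b < n, d b ≤ b) :
    (pairSystem n d).card = 1 + ∑ b ∈ Finset.range n, d b := by
  rw [pairSystem, Finset.card_insert_of_notMem, Finset.card_image_of_injOn]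
  · simp [add_comm]
  · rintro ⟨b, a⟩ h ⟨b', a'⟩ h' heq
    simp only [Finset.coe_sigma, Finset.coe_range, Set.mem_sigma_iff, Set.mem_Iio] at h h'
    have h1 := hd b h.1
    have h2 := hd b' h'.1
    simp only [Finset.ext_iff, Finset.mem_insert, Finset.mem_singleton] at heq
    have e1 := heq a
    have e2 := heq b
    have e3 := heq a'
    have e4 := heq b'
    obtain ⟨rfl, rfl⟩ : b = b' ∧ a = a' := by omega
    rfl
  · simp only [Finset.mem_image, not_exists, not_and]
    intro p _ h
    exact Finset.insert_ne_empty _ _ h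

/-- An upper bound suffices, since spare output forms can be zero. -/
theorem card_tripleSystem_le (n : ℕ) (d : ℕ → ℕ) :
    (tripleSystem n d).card ≤ n + ∑ b ∈ Finset.range n, d b * (n - b - 1) := by
  refine (Finset.card_union_le _ _).trans (add_le_add ?_ ?_)
  · exact Finset.card_image_le.trans (by simp)
  · exact Finset.card_image_le.trans (by simp)

theorem triple_mem_tripleSystem {n a b c : ℕ} {d : ℕ → ℕ} (h : a < d b) (hbc : b < c)
    (hc : c < n) : {a, b, c} ∈ tripleSystem n d := by
  refine Finset.mem_union_right _ (Finset.mem_image.2 ⟨⟨b, a, c⟩, ?_, rfl⟩)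
  simp only [Finset.mem_sigma, Finset.mem_product, Finset.mem_range, Finset.mem_Ioo]
  omega

theorem singleton_mem_tripleSystem {n a : ℕ} {d : ℕ → ℕ} (h : a < n) :
    {a} ∈ tripleSystem n d :=
  Finset.mem_union_left _ (Finset.mem_image.2 ⟨a, Finset.mem_range.2 h, rfl⟩)

/-- By `hc`, a triple with any edge of `d` has its two smallest vertices joined in `d₀`. Keeping
`d₀` apart from `d` lets edges be added while the outputs stay fixed. -/
theorem symmDiff_mem_tripleSystem {n : ℕ} {d d₀ : ℕ → ℕ} (hd : ∀ b < n, d b ≤ b)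
    (hc : ∀ a b c, a < b → b < c → c < n → (a < d b ∨ a < d c ∨ b < d c) → a < d₀ b)
    {i : ℕ} (hi : i < n) {S : Finset ℕ} (hS : S ∈ pairSystem n d) :
    symmDiff {i} S ∈ tripleSystem n d₀ := by
  rcases Finset.mem_insert.1 hS with rfl | hS
  · rw [← Finset.bot_eq_empty, symmDiff_bot]
    exact singleton_mem_tripleSystem hi
  · obtain ⟨⟨b, a⟩, hp, rfl⟩ := Finset.mem_image.1 hS
    simp only [Finset.mem_sigma, Finset.mem_range] at hp ⊢
    obtain ⟨hb, ha⟩ := hp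
    have hab : a < b := ha.trans_le (hd b hb)
    have key : ∀ T : Finset ℕ, T ∈ tripleSystem n d₀ →
        (∀ j, j ∈ T ↔ (j = i ∧ j ≠ a ∧ j ≠ b) ∨ (j ≠ i ∧ (j = a ∨ j = b))) →
        symmDiff {i} {a, b} ∈ tripleSystem n d₀ := by
      intro T hT h
      convert hT using 1
      ext j
      rw [h j]
      simp only [Finset.mem_symmDiff, Finset.mem_insert, Finset.mem_singleton]
      tauto
    rcases lt_trichotomy i a with h | rfl | h
    · refine key {i, a, b} (triple_mem_tripleSystem
        (hc i a b h hab hb (Or.inr (Or.inr ha))) hab hb) fun j => ?_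
      simp only [Finset.mem_insert, Finset.mem_singleton]; omega
    · refine key {b} (singleton_mem_tripleSystem hb) fun j => ?_
      simp only [Finset.mem_singleton]; omega
    · rcases lt_trichotomy i b with h' | rfl | h'
      · refine key {a, i, b} (triple_mem_tripleSystem
          (hc a i b h h' hb (Or.inr (Or.inl ha))) h' hb) fun j => ?_
        simp only [Finset.mem_insert, Finset.mem_singleton]; omega
      · refine key {a} (singleton_mem_tripleSystem (hab.trans hb)) fun j => ?_
        simp only [Finset.mem_singleton]; omega
      · refine key {a, b, i} (triple_mem_tripleSystem
          (hc a b i hab h' hi (Or.inl ha)) h' hi) fun j => ?_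
        simp only [Finset.mem_insert, Finset.mem_singleton]; omega

theorem HasSquareIdentity.of_pairs {K : Type*} [Field K] [CharZero K] (n : ℕ) (d d₀ : ℕ → ℕ)
    (hd : ∀ b < n, d b ≤ b)
    (hc : ∀ a b c, a < b → b < c → c < n → (a < d b ∨ a < d c ∨ b < d c) → a < d₀ b)
    {r s N : ℕ} (hr : r ≤ 2 * n) (hs : s ≤ 2 * (1 + ∑ b ∈ Finset.range n, d b))
    (hN : 2 * (n + ∑ b ∈ Finset.range n, d₀ b * (n - b - 1)) ≤ N) :
    HasSquareIdentity K r s N :=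
  .of_set_systems n (pairSystem n d) (tripleSystem n d₀)
    (fun _ hi _ hS => symmDiff_mem_tripleSystem hd hc hi hS) hr
    (by rwa [card_pairSystem n d hd])
    ((Nat.mul_le_mul_left 2 (card_tripleSystem_le n d₀)).trans hN)

/-! ### Cliques with one partial vertex, and the count of `N` -/

/-- The numbers `d b` of pairs `{a, b}` with `a < b` when the first `m` points are joined to each
other and the point `m` is joined to the first `l` points. -/
def cliqueDegree (m l b : ℕ) : ℕ := if b < m then b else if b = m then l else 0

theorem sum_cliqueDegree_mul (m l n : ℕ) (h : m < n) (f : ℕ → ℕ) :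
    ∑ b ∈ Finset.range n, cliqueDegree m l b * f b
      = (∑ b ∈ Finset.range m, b * f b) + l * f m := by
  obtain ⟨t, rfl⟩ : ∃ t, n = m + 1 + t := ⟨n - (m + 1), by omega⟩
  rw [Finset.sum_range_add, Finset.sum_range_succ, Finset.sum_eq_zero (s := Finset.range t)]
  · rw [add_zero]
    congr 1
    · refine Finset.sum_congr rfl fun b hb => ?_
      simp [cliqueDegree, Finset.mem_range.1 hb]
    · simp [cliqueDegree]
  · intro b _
    have h1 : ¬ m + 1 + b < m := by omega
    have h2 : ¬ m + 1 + b = m := by omega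
    simp [cliqueDegree, h1, h2]

theorem sum_cliqueDegree (m l n : ℕ) (h : m < n) :
    ∑ b ∈ Finset.range n, cliqueDegree m l b = m.choose 2 + l := by
  simpa [Finset.sum_range_id, Nat.choose_two_right] using
    sum_cliqueDegree_mul m l n h (fun _ => 1)

theorem sum_range_mul_sub (m n : ℕ) (h : m ≤ n) :
    ((∑ b ∈ Finset.range m, b * (n - b - 1) : ℕ) : ℤ)
      = (m.choose 2 : ℤ) * n - 2 * ((m + 1).choose 3 : ℤ) := by
  induction m with
  | zero => simp [Nat.choose_eq_zero_of_lt]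
  | succ m ih =>
    rw [Finset.sum_range_succ, Nat.cast_add, ih (by omega), Nat.choose_succ_succ' (m + 1) 2,
      Nat.choose_succ_succ' m 1, Nat.choose_one_right]
    have h2 : ((m.choose 2 : ℕ) : ℤ) * 2 = m * (m - 1) := by
      have := Nat.choose_two_right m
      have h' := Nat.div_mul_cancel (Nat.even_mul_pred_self m).two_dvd
      rw [← this] at h'
      zify at h'
      rw [h']
      cases m <;> simp
    have h3 : ((n - m - 1 : ℕ) : ℤ) = n - m - 1 := by omega
    push_cast
    rw [h3]
    linear_combination h2

/-- The four families of square identities obtained from `n` anticommuting pairs of translations. -/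
theorem exists_squareIdentities {K : Type*} [Field K] [CharZero K] (n l k r : ℕ)
    (hlk : l < k) (hkn : k ≤ n) (hr : r ≤ 2 * n) :
    ∃ N : ℕ, (N : ℤ) = 2 * (((k - 1).choose 2 : ℤ) + (l : ℤ) + 1) * (n : ℤ)
          - 4 * (k.choose 3 : ℤ) - 2 * (k : ℤ) * (l : ℤ) ∧
      HasSquareIdentity K r (2 * ((k - 1).choose 2 + l + 1)) N ∧
      (k + 1 = n → HasSquareIdentity K r (2 * ((k - 1).choose 2 + l + 1) + 2 * l) N) ∧
      (k + 1 = n → l + 2 = n →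
        HasSquareIdentity K r (2 * ((k - 1).choose 2 + l + 1) + 2 * l + 2) N) ∧
      (k = n → HasSquareIdentity K r (2 * ((k - 1).choose 2 + l + 1) + 2 * (n - 1 - l)) N) := by
  obtain ⟨m, rfl⟩ : ∃ m, k = m + 1 := ⟨k - 1, by omega⟩
  simp only [Nat.add_sub_cancel]
  refine ⟨2 * (n + ∑ b ∈ Finset.range n, cliqueDegree m l b * (n - b - 1)), ?_, ?_, ?_, ?_, ?_⟩
  · rw [sum_cliqueDegree_mul m l n (by omega)]
    have h3 : ((n - m - 1 : ℕ) : ℤ) = n - m - 1 := by omega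
    rw [Nat.cast_mul, Nat.cast_add, Nat.cast_add, Nat.cast_mul,
      sum_range_mul_sub m n (by omega), h3]
    push_cast
    ring
  · refine .of_pairs n (cliqueDegree m l) (cliqueDegree m l) ?_ ?_ hr ?_ le_rfl
    · intro b _; unfold cliqueDegree; split_ifs <;> omega
    · intro a b c; unfold cliqueDegree; split_ifs <;> omega
    · rw [sum_cliqueDegree m l n (by omega)]; omega
  · rintro rfl
    -- The last vertex copies the neighbours of vertex `m`; as it is never the middle of a triple,
    -- no new triple arises.
    refine .of_pairs _ (fun b => if b = m + 1 then l else cliqueDegree m l b) (cliqueDegree m l)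
      ?_ ?_ hr ?_ le_rfl
    · intro b _; unfold cliqueDegree; split_ifs <;> omega
    · intro a b c; unfold cliqueDegree; split_ifs <;> omega
    · rw [Finset.sum_range_succ, if_pos rfl, Finset.sum_congr rfl (fun b hb => if_neg
        (Finset.mem_range.1 hb).ne), sum_cliqueDegree m l _ (by omega)]
      omega
  · rintro rfl hl'
    obtain rfl : l = m := by omega
    -- All vertices but the last already form a clique, so every triple is present and the complete
    -- graph is allowed.
    refine .of_pairs _ id (cliqueDegree l l) (fun _ _ => le_rfl) ?_ hr ?_ le_rfl
    · intro a b c; unfold cliqueDegree; dsimp only [id]; split_ifs <;> omega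
    · simp only [id, Finset.sum_range_succ, Finset.sum_range_id, ← Nat.choose_two_right]
      omega
  · rintro rfl
    -- Here `m` is the last vertex, so again every triple is present; completing the graph adds `m -
    -- l` edges.
    refine .of_pairs _ id (cliqueDegree m l) (fun _ _ => le_rfl) ?_ hr ?_ le_rfl
    · intro a b c; unfold cliqueDegree; dsimp only [id]; split_ifs <;> omega
    · simp only [id, Finset.sum_range_succ, Finset.sum_range_id, ← Nat.choose_two_right]
      omega

theorem hurwitzRadon_two_pow (n : ℕ) : hurwitzRadon (2 ^ n) = 8 * (n / 4) + 2 ^ (n % 4) := by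
  simp [hurwitzRadon]

theorem hurwitzRadon_two_pow_of_one_or_two {n : ℕ} (h : n % 4 = 1 ∨ n % 4 = 2) :
    hurwitzRadon (2 ^ n) = 2 * n := by
  rw [hurwitzRadon_two_pow]
  rcases h with h | h <;> rw [h] <;> omega

theorem hurwitzRadon_two_pow_le {n : ℕ} (h : n % 4 = 0 ∨ n % 4 = 3) :
    hurwitzRadon (2 ^ n) ≤ 2 * (n + 1) := by
  rw [hurwitzRadon_two_pow]
  rcases h with h | h <;> rw [h] <;> omega

theorem mainTheorem5 (n l k : ℕ) (hn : 4 < n) (hl : 1 ≤ l) (hlk : l < k) (hkn : k ≤ n)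
    (s : ℕ) (hs : s = 2 * ((k - 1).choose 2 + l + 1)) :
    (n % 4 = 1 ∨ n % 4 = 2 →
      ∃ N : ℕ,
        (N : ℤ) = 2 * (((k - 1).choose 2 : ℤ) + (l : ℤ) + 1) * (n : ℤ)
          - 4 * (k.choose 3 : ℤ) - 2 * (k : ℤ) * (l : ℤ) ∧
        (k + 2 ≤ n → HasSquareIdentity ℝ (hurwitzRadon (2 ^ n)) s N) ∧
        (k + 1 = n → l + 3 ≤ n →
          HasSquareIdentity ℝ (hurwitzRadon (2 ^ n)) (s + 2 * l) N) ∧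
        (k + 1 = n → l + 2 = n →
          HasSquareIdentity ℝ (hurwitzRadon (2 ^ n)) (s + 2 * l + 2) N) ∧
        (k = n →
          HasSquareIdentity ℝ (hurwitzRadon (2 ^ n)) (s + 2 * (n - 1 - l)) N)) ∧
    (8 ≤ n → n % 4 = 0 ∨ n % 4 = 3 →
      ∃ N : ℕ,
        (N : ℤ) = 2 * (((k - 1).choose 2 : ℤ) + (l : ℤ) + 1) * ((n : ℤ) + 1)
          - 4 * (k.choose 3 : ℤ) - 2 * (k : ℤ) * (l : ℤ) ∧
        (k + 1 ≤ n → HasSquareIdentity ℝ (hurwitzRadon (2 ^ n)) s N) ∧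
        (k = n → l + 2 ≤ n →
          HasSquareIdentity ℝ (hurwitzRadon (2 ^ n)) (s + 2 * l) N) ∧
        (k = n → l + 1 = n →
          HasSquareIdentity ℝ (hurwitzRadon (2 ^ n)) (s + 2 * l + 2) N)) := by
  subst hs
  refine ⟨fun h => ?_, fun _ h => ?_⟩
  · obtain ⟨N, hN, h1, h2, h3, h4⟩ := exists_squareIdentities (K := ℝ) n l k _ hlk hkn
      (hurwitzRadon_two_pow_of_one_or_two h).le
    exact ⟨N, hN, fun _ => h1, fun hk _ => h2 hk, h3, h4⟩
  · obtain ⟨N, hN, h1, h2, h3, -⟩ := exists_squareIdentities (K := ℝ) (n + 1) l k _ hlk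
      (by omega) (hurwitzRadon_two_pow_le h)
    refine ⟨N, by simpa using hN, fun _ => h1, fun hk _ => h2 (by omega),
      fun hk hl' => h3 (by omega) (by omega)⟩
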